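/- **Definitions.** Let $H$ be a complex Hilbert space and $\rho>0$. Let $C_\rho(H)$ be the set of bounded operators $T$ on $H$ that admit a unitary $\rho$-dilation: there are a Hilbert space $\mathcal H$ containing $H$ as a closed subspace and a unitary operator $U$ on $\mathcal H$ with $T^n=\rho\,P_HU^n|_H$ for all $n\ge 1$, where $P_H$ is the orthogonal projection of $\mathcal H$ onto $H$. For $T\in C_\rho(H)$ and $|z|<1$ put $$K_z^\rho(T)=(I-\bar zT)^{-1}+(I-zT^*)^{-1}+(\rho-2)I .$$ For $T_0,T_1\in C_\rho(H)$, say that $T_1$ is Harnack dominated by $T_0$ if there is a constant $c\ge1$ with $K_z^\rho(T_1)\le c^2K_z^\rho(T_0)$ for all $|z|<1$, and that $T_0,T_1$ are Harnack equivalent if each is Harnack dominated by the other. The equivalence class of $T_0\in C_\rho(H)$ is called the Harnack part of $T_0$ in $C_\rho(H)$. **Theorem.** Let $a\in\mathbb C$ with $|a|=\sqrt2$, and let $$N=\begin{pmatrix}0&a&0\\0&0&a\\0&0&0\end{pmatrix},$$ regarded as an operator on the Hilbert space $\mathbb C^3$. Then $N\in C_2(\mathbb C^3)$, and the Harnack part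 of $N$ in $C_2(\mathbb C^3)$ is exactly the set of matrices $$a\begin{pmatrix}0&e^{-i\theta}&0\\0&0&e^{i\theta}\\0&0&0\end{pmatrix},\qquad\theta\in\mathbb R .$$ Moreover, this set is the orbit $\{U_\theta^*NU_\theta:\theta\in\mathbb R\}$ of $N$ under conjugation by the unitary matrices $U_\theta=\operatorname{diag}(e^{i\theta},1,e^{i\theta})$. -/

import Mathlib

universe u

section HarnackParts

variable {H : Type u} [NormedAddCommGroup H] [InnerProductSpace ℂ H] [CompleteSpace H]

/-- `T` admits a unitary `ρ`-dilation, i.e. `T` belongs to the class `C_ρ(H)` (for `ρ > 0`): there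
are a Hilbert space `K`, an isometric embedding `V : H → K` (which realizes `H` as a closed subspace
of `K`) and a unitary operator `U` on `K` with `T ^ n = ρ P_H U ^ n |_H` for every `n ≥ 1`.
Through the embedding `V`, the compression `P_H A |_H` of an operator `A` on `K` is `V* A V`. -/
def IsRhoContraction (ρ : ℝ) (T : H →L[ℂ] H) : Prop :=
  ∃ (K : Type u) (_ : NormedAddCommGroup K) (_ : InnerProductSpace ℂ K) (_ : CompleteSpace K)
    (V : H →ₗᵢ[ℂ] K) (U : K →L[ℂ] K), U ∈ unitary (K →L[ℂ] K) ∧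
      ∀ n : ℕ, 1 ≤ n →
        T ^ n = (ρ : ℂ) •
          (ContinuousLinearMap.adjoint V.toContinuousLinearMap ∘L (U ^ n) ∘L
            V.toContinuousLinearMap)

/-- The operatorial `ρ`-kernel
`K_z^ρ(T) = (I - conj z T)⁻¹ + (I - z T*)⁻¹ + (ρ - 2) I`.
For `T` in `C_ρ(H)` and `|z| < 1` the two inverses exist, because the spectrum of `T` lies in the
closed unit disc. -/
noncomputable def rhoKernel (ρ : ℝ) (T : H →L[ℂ] H) (z : ℂ) : H →L[ℂ] H :=
  Ring.inverse (1 - (starRingEnd ℂ z) • T)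
    + Ring.inverse (1 - z • ContinuousLinearMap.adjoint T)
    + ((ρ : ℂ) - 2) • (1 : H →L[ℂ] H)

/-- `T₁` is Harnack dominated by `T₀` in `C_ρ(H)`: both operators are in `C_ρ(H)` and, for some
`c ≥ 1`, `K_z^ρ(T₁) ≤ c² K_z^ρ(T₀)` for all `z` in the open unit disc, in the usual (Loewner)
order: the difference of the two sides is a positive operator. -/
def HarnackDominated (ρ : ℝ) (T₁ T₀ : H →L[ℂ] H) : Prop :=
  IsRhoContraction ρ T₁ ∧ IsRhoContraction ρ T₀ ∧
    ∃ c : ℝ, 1 ≤ c ∧ ∀ z : ℂ, ‖z‖ < 1 →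
      (((c : ℂ) ^ 2) • rhoKernel ρ T₀ z - rhoKernel ρ T₁ z).IsPositive

/-- Harnack equivalence in `C_ρ(H)`: each operator is Harnack dominated by the other one. -/
def HarnackEquivalent (ρ : ℝ) (T₁ T₀ : H →L[ℂ] H) : Prop :=
  HarnackDominated ρ T₁ T₀ ∧ HarnackDominated ρ T₀ T₁

/-- The Harnack part of `T₀` in `C_ρ(H)`: its class under Harnack equivalence. -/
def harnackPart (ρ : ℝ) (T₀ : H →L[ℂ] H) : Set (H →L[ℂ] H) :=
  {T | HarnackEquivalent ρ T T₀}

end HarnackParts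

/-- The nilpotent matrix with rows `(0, a, 0)`, `(0, 0, a)`, `(0, 0, 0)`. -/
def nilpotentMatrix (a : ℂ) : Matrix (Fin 3) (Fin 3) ℂ :=
  !![0, a, 0; 0, 0, a; 0, 0, 0]

/-- The diagonal matrix `diag(e^{iθ}, 1, e^{iθ})`. -/
noncomputable def diagUnitary (θ : ℝ) : Matrix (Fin 3) (Fin 3) ℂ :=
  Matrix.diagonal ![Complex.exp (Complex.I * θ), 1, Complex.exp (Complex.I * θ)]

section FourierCoefficients

lemma integral_exp_int_mul_I (n : ℤ) :
    ∫ t in (0 : ℝ)..2 * Real.pi, Complex.exp (n * t * Complex.I)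
      = if n = 0 then 2 * (Real.pi : ℂ) else 0 := by
  split_ifs with h
  · simp [h]
  · have hn : (n : ℂ) * Complex.I ≠ 0 := by simp [h]
    have := integral_exp_mul_complex (a := 0) (b := 2 * Real.pi) hn
    rw [show (fun t : ℝ => Complex.exp (n * t * Complex.I))
      = fun t : ℝ => Complex.exp (n * Complex.I * t) by ext t; ring_nf, this]
    have h2 : Complex.exp (n * Complex.I * ((2 * Real.pi : ℝ) : ℂ)) = 1 := by
      rw [← Complex.exp_int_mul_two_pi_mul_I n]; push_cast; ring_nf
    rw [h2]; simp

/-- The Fourier coefficients of an absolutely convergent trigonometric series are bounded by any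
uniform bound on its sum. -/
lemma norm_coeff_le_of_trigonometric_series {E : Type*} [NormedAddCommGroup E] [NormedSpace ℂ E]
    [CompleteSpace E] {c : ℤ → E} (hc : Summable fun k => ‖c k‖) {F : ℝ → E}
    (hF : ∀ t : ℝ, HasSum (fun k : ℤ => Complex.exp (k * t * Complex.I) • c k) (F t))
    {ε : ℝ} (hε : ∀ t, ‖F t‖ ≤ ε) (k : ℤ) : ‖c k‖ ≤ ε := by
  have hexp : ∀ (m : ℤ) (t : ℝ), ‖Complex.exp (m * t * Complex.I)‖ = 1 := fun m t => by
    simpa using Complex.norm_exp_ofReal_mul_I ((m : ℝ) * t)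
  have hsum : HasSum
      (fun m : ℤ => ∫ t in (0 : ℝ)..2 * Real.pi, Complex.exp ((m - k : ℤ) * t * Complex.I) • c m)
      (∫ t in (0 : ℝ)..2 * Real.pi, Complex.exp ((-k : ℤ) * t * Complex.I) • F t) := by
    refine intervalIntegral.hasSum_integral_of_dominated_convergence (fun m _ => ‖c m‖)
      (fun m => ?_) (fun m => ?_) ?_ ?_ ?_
    · exact Continuous.aestronglyMeasurable (by fun_prop)
    · refine Filter.Eventually.of_forall fun t _ => ?_
      rw [norm_smul, hexp, one_mul]
    · exact Filter.Eventually.of_forall fun t _ => hc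
    · exact intervalIntegrable_const
    · refine Filter.Eventually.of_forall fun t _ => ?_
      convert (hF t).const_smul (Complex.exp ((-k : ℤ) * t * Complex.I)) using 2 with m
      rw [smul_smul, ← Complex.exp_add]
      push_cast; ring_nf
  have hval : (∫ t in (0 : ℝ)..2 * Real.pi, Complex.exp ((-k : ℤ) * t * Complex.I) • F t)
      = (2 * (Real.pi : ℂ)) • c k := by
    rw [← hsum.tsum_eq, tsum_eq_single k]
    · rw [intervalIntegral.integral_smul_const, integral_exp_int_mul_I]; simp
    · intro m hm
      rw [intervalIntegral.integral_smul_const, integral_exp_int_mul_I, if_neg (sub_ne_zero.2 hm),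
        zero_smul]
  have hle := intervalIntegral.norm_integral_le_of_norm_le_const (a := 0) (b := 2 * Real.pi)
    (C := ε) (f := fun t : ℝ => Complex.exp ((-k : ℤ) * t * Complex.I) • F t) (fun t _ => by
      rw [norm_smul, hexp, one_mul]; exact hε t)
  rw [hval, norm_smul] at hle
  have hpi := Real.pi_pos
  have h2 : ‖2 * (Real.pi : ℂ)‖ = 2 * Real.pi := by
    rw [norm_mul, Complex.norm_real, Real.norm_of_nonneg hpi.le]; simp
  rw [h2, sub_zero, abs_of_pos (by positivity), mul_comm ε] at hle
  exact le_of_mul_le_mul_left hle (by positivity)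

end FourierCoefficients

/-- A positive operator whose quadratic form is bounded by `C` satisfies `A² ≤ C A`. -/
lemma ContinuousLinearMap.IsPositive.norm_apply_sq_le {H : Type*}
    [NormedAddCommGroup H] [InnerProductSpace ℂ H] {A : H →L[ℂ] H} (hA : A.IsPositive) {C : ℝ}
    (hC : 0 < C) (hAC : ∀ x, (inner ℂ (A x) x).re ≤ C * ‖x‖ ^ 2) (x : H) :
    ‖A x‖ ^ 2 ≤ C * (inner ℂ (A x) x).re := by
  have h1 := hA.re_inner_nonneg_left (x - ((C⁻¹ : ℝ) : ℂ) • A x)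
  have h2 := hAC (A x)
  have h3 : inner ℂ (A (A x)) x = inner ℂ (A x) (A x) := hA.isSymmetric _ _
  have h4 : (inner ℂ (A x) (A x)).re = ‖A x‖ ^ 2 := by
    rw [inner_self_eq_norm_sq_to_K]; norm_cast
  simp only [map_sub, map_smul, inner_sub_left, inner_sub_right, inner_smul_left, inner_smul_right,
    h3, Complex.conj_ofReal, RCLike.re_to_complex, Complex.sub_re, Complex.re_ofReal_mul, h4] at h1
  have h5 : C⁻¹ * (C⁻¹ * (inner ℂ (A (A x)) (A x)).re) ≤ C⁻¹ * ‖A x‖ ^ 2 := by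
    have : C⁻¹ * (inner ℂ (A (A x)) (A x)).re ≤ ‖A x‖ ^ 2 := by
      rw [inv_mul_le_iff₀ hC]; exact h2
    gcongr
  have h6 : C⁻¹ * ‖A x‖ ^ 2 ≤ (inner ℂ (A x) x).re := by linarith
  rwa [inv_mul_le_iff₀ hC] at h6

section RhoKernel

variable {H : Type*} [NormedAddCommGroup H] [InnerProductSpace ℂ H] [CompleteSpace H]

lemma IsRhoContraction.exists_norm_pow_le {ρ : ℝ} {T : H →L[ℂ] H} (hT : IsRhoContraction ρ T) :
    ∃ M : ℝ, ∀ n : ℕ, ‖T ^ n‖ ≤ M := by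
  obtain ⟨K, _, _, _, V, U, hU, h⟩ := hT
  refine ⟨max 1 ‖(ρ : ℂ)‖, fun n => ?_⟩
  rcases Nat.eq_zero_or_pos n with rfl | hn
  · rw [pow_zero]
    exact (ContinuousLinearMap.norm_id_le).trans (le_max_left _ _)
  · rw [h n hn, norm_smul]
    refine le_trans ?_ (le_max_right _ _)
    refine mul_le_of_le_one_right (norm_nonneg _) ?_
    have hV : ‖V.toContinuousLinearMap‖ ≤ 1 := V.norm_toContinuousLinearMap_le
    have hUn : ‖U ^ n‖ ≤ 1 := ContinuousLinearMap.opNorm_le_bound _ zero_le_one fun x => by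
      rw [ContinuousLinearMap.norm_map_of_mem_unitary (pow_mem hU n), one_mul]
    refine (ContinuousLinearMap.opNorm_comp_le _ _).trans
      (mul_le_one₀ ?_ (norm_nonneg _) ((ContinuousLinearMap.opNorm_comp_le _ _).trans
        (mul_le_one₀ hUn (norm_nonneg _) hV)))
    rwa [LinearIsometryEquiv.norm_map]

lemma norm_adjoint_pow (T : H →L[ℂ] H) (n : ℕ) :
    ‖ContinuousLinearMap.adjoint T ^ n‖ = ‖T ^ n‖ := by
  rw [← ContinuousLinearMap.star_eq_adjoint, ← star_pow, norm_star]

lemma summable_norm_smul_pow {T : H →L[ℂ] H} {M : ℝ} (hM : ∀ n : ℕ, ‖T ^ n‖ ≤ M) {z : ℂ}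
    (hz : ‖z‖ < 1) : Summable fun n : ℕ => ‖(z • T) ^ n‖ := by
  refine Summable.of_nonneg_of_le (fun _ => norm_nonneg _) (fun n => ?_)
    ((summable_geometric_of_lt_one (norm_nonneg z) hz).mul_right M)
  rw [smul_pow, norm_smul, norm_pow]
  gcongr
  exact hM n

lemma hasSum_ringInverse_one_sub {T : H →L[ℂ] H} (h : Summable fun n : ℕ => ‖T ^ n‖) :
    HasSum (fun n : ℕ => T ^ n) (Ring.inverse (1 - T)) := by
  have hs : Summable fun n : ℕ => T ^ n := h.of_norm
  let u : (H →L[ℂ] H)ˣ := ⟨1 - T, ∑' n, T ^ n, hs.one_sub_mul_tsum_pow, hs.tsum_pow_mul_one_sub⟩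
  have : Ring.inverse (1 - T) = ∑' n, T ^ n := Ring.inverse_unit u
  rw [this]
  exact hs.hasSum

/-- The coefficients of the harmonic expansion of the `ρ`-kernel. -/
noncomputable def rhoMoment (ρ : ℝ) (T : H →L[ℂ] H) : ℤ → (H →L[ℂ] H)
  | Int.ofNat 0 => (ρ : ℂ) • 1
  | Int.ofNat (n + 1) => ContinuousLinearMap.adjoint T ^ (n + 1)
  | Int.negSucc n => T ^ (n + 1)

lemma exists_norm_rhoMoment_le {ρ : ℝ} {T : H →L[ℂ] H} (hT : IsRhoContraction ρ T) :
    ∃ M : ℝ, ∀ k : ℤ, ‖rhoMoment ρ T k‖ ≤ M := by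
  obtain ⟨M, hM⟩ := hT.exists_norm_pow_le
  refine ⟨max ‖(ρ : ℂ) • (1 : H →L[ℂ] H)‖ M, fun k => ?_⟩
  match k with
  | Int.ofNat 0 => exact le_max_left _ _
  | Int.ofNat (n + 1) => exact (norm_adjoint_pow T (n + 1)).le.trans ((hM _).trans (le_max_right _ _))
  | Int.negSucc n => exact (hM _).trans (le_max_right _ _)

lemma hasSum_rhoKernel {ρ : ℝ} {T : H →L[ℂ] H} (hT : IsRhoContraction ρ T) {r : ℝ} (h0 : 0 ≤ r)
    (h1 : r < 1) (t : ℝ) :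
    HasSum (fun k : ℤ => Complex.exp (k * t * Complex.I) • ((r ^ k.natAbs : ℝ) : ℂ) • rhoMoment ρ T k)
      (rhoKernel ρ T (r * Complex.exp (t * Complex.I))) := by
  obtain ⟨M, hM⟩ := hT.exists_norm_pow_le
  set z : ℂ := r * Complex.exp (t * Complex.I) with hz
  have hzn : ‖z‖ < 1 := by
    rw [hz, norm_mul, Complex.norm_exp_ofReal_mul_I, Complex.norm_real, Real.norm_of_nonneg h0,
      mul_one]; exact h1
  have hzc : (starRingEnd ℂ) z = r * Complex.exp (-(t * Complex.I)) := by
    rw [hz, map_mul, Complex.conj_ofReal, ← Complex.exp_conj]; simp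
  have hpos := hasSum_ringInverse_one_sub (T := z • ContinuousLinearMap.adjoint T)
    (summable_norm_smul_pow (M := M) (fun n => (norm_adjoint_pow T n).le.trans (hM n)) hzn)
  have hneg := hasSum_ringInverse_one_sub (T := (starRingEnd ℂ) z • T)
    (summable_norm_smul_pow (M := M) hM (by simpa using hzn))
  rw [← hasSum_nat_add_iff' 1] at hpos hneg
  simp only [Finset.range_one, Finset.sum_singleton, pow_zero] at hpos hneg
  have epos : ∀ n : ℕ, (z • ContinuousLinearMap.adjoint T) ^ (n + 1)
      = Complex.exp (((n + 1 : ℕ) : ℤ) * t * Complex.I) •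
        ((r ^ ((n + 1 : ℕ) : ℤ).natAbs : ℝ) : ℂ) • rhoMoment ρ T ((n + 1 : ℕ) : ℤ) := by
    intro n
    rw [show rhoMoment ρ T ((n + 1 : ℕ) : ℤ) = ContinuousLinearMap.adjoint T ^ (n + 1) from rfl,
      smul_pow, smul_smul, hz, mul_pow, ← Complex.exp_nat_mul, Int.natAbs_natCast]
    congr 1
    push_cast; ring_nf
  have eneg : ∀ n : ℕ, ((starRingEnd ℂ) z • T) ^ (n + 1)
      = Complex.exp ((-((n : ℤ) + 1) : ℤ) * t * Complex.I) •
        ((r ^ (-((n : ℤ) + 1)).natAbs : ℝ) : ℂ) • rhoMoment ρ T (-((n : ℤ) + 1)) := by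
    intro n
    rw [show (-((n : ℤ) + 1)) = Int.negSucc n by omega,
      show rhoMoment ρ T (Int.negSucc n) = T ^ (n + 1) from rfl,
      smul_pow, smul_smul, hzc, mul_pow, ← Complex.exp_nat_mul, Int.natAbs_negSucc,
      Int.cast_negSucc, Nat.succ_eq_add_one]
    congr 1
    push_cast; ring_nf
  simp only [epos] at hpos
  simp only [eneg] at hneg
  have hpos' := (hasSum_nat_add_iff (f := fun n : ℕ => Complex.exp ((n : ℤ) * t * Complex.I) •
      ((r ^ (n : ℤ).natAbs : ℝ) : ℂ) • rhoMoment ρ T n) 1).1 hpos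
  have h0' : rhoMoment ρ T 0 = (ρ : ℂ) • 1 := rfl
  have hsum := HasSum.of_nat_of_neg_add_one (f := fun k : ℤ =>
    Complex.exp (k * t * Complex.I) • ((r ^ k.natAbs : ℝ) : ℂ) • rhoMoment ρ T k) hpos' hneg
  have hval : rhoKernel ρ T z = Ring.inverse (1 - z • ContinuousLinearMap.adjoint T) - 1
      + (ρ : ℂ) • 1 + (Ring.inverse (1 - (starRingEnd ℂ) z • T) - 1) := by
    rw [rhoKernel, sub_smul, two_smul]
    abel
  rw [hval]
  simpa [h0'] using hsum

lemma hasSum_rhoKernel_apply {ρ : ℝ} {T : H →L[ℂ] H} (hT : IsRhoContraction ρ T) {r : ℝ}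
    (h0 : 0 ≤ r) (h1 : r < 1) (t : ℝ) (x : H) :
    HasSum (fun k : ℤ => Complex.exp (k * t * Complex.I) • ((r ^ k.natAbs : ℝ) : ℂ) •
      rhoMoment ρ T k x) (rhoKernel ρ T (r * Complex.exp (t * Complex.I)) x) :=
  (ContinuousLinearMap.apply ℂ H x).hasSum (hasSum_rhoKernel hT h0 h1 t)

lemma summable_norm_pow_smul_rhoMoment {ρ : ℝ} {T : H →L[ℂ] H} (hT : IsRhoContraction ρ T) {r : ℝ}
    (h0 : 0 ≤ r) (h1 : r < 1) (x : H) :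
    Summable fun k : ℤ => ‖((r ^ k.natAbs : ℝ) : ℂ) • rhoMoment ρ T k x‖ := by
  obtain ⟨M, hM⟩ := exists_norm_rhoMoment_le hT
  have hs : Summable fun k : ℤ => r ^ k.natAbs := by
    refine Summable.of_nat_of_neg ?_ ?_ <;>
    simpa using summable_geometric_of_lt_one h0 h1
  refine Summable.of_nonneg_of_le (fun _ => norm_nonneg _) (fun k => ?_) (hs.mul_right (M * ‖x‖))
  rw [norm_smul, Complex.norm_real, Real.norm_of_nonneg (by positivity)]
  gcongr
  exact (rhoMoment ρ T k).le_of_opNorm_le (hM k) x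

/-- If the kernel of `T` asymptotically annihilates `v - e^{2it} w` on the unit circle, then the
moments of `T` satisfy a two-step recursion. -/
lemma rhoMoment_apply_eq_of_rhoKernel_le {ρ : ℝ} {T : H →L[ℂ] H} (hT : IsRhoContraction ρ T)
    {v w : H} {C : ℝ}
    (h : ∀ r : ℝ, 0 ≤ r → r < 1 → ∀ t : ℝ,
      ‖rhoKernel ρ T (r * Complex.exp (t * Complex.I))
        (v - Complex.exp (2 * t * Complex.I) • w)‖ ^ 2 ≤ C * (1 - r ^ 2)) (k : ℤ) :
    rhoMoment ρ T k v = rhoMoment ρ T (k - 2) w := by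
  let B : ℝ → H → ℤ → H := fun r x k => ((r ^ k.natAbs : ℝ) : ℂ) • rhoMoment ρ T k x
  have key : ∀ r : ℝ, 0 ≤ r → r < 1 → ‖B r v k - B r w (k - 2)‖ ≤ √(C * (1 - r ^ 2)) := by
    intro r h0 h1
    have hs1 : Summable fun k : ℤ => ‖B r v k‖ := summable_norm_pow_smul_rhoMoment hT h0 h1 v
    have hs2 : Summable fun k : ℤ => ‖B r w (k - 2)‖ :=
      (Equiv.subRight (2 : ℤ)).summable_iff (f := fun k => ‖B r w k‖) |>.2
        (summable_norm_pow_smul_rhoMoment hT h0 h1 w)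
    refine norm_coeff_le_of_trigonometric_series (c := fun k => B r v k - B r w (k - 2))
      (F := fun t => rhoKernel ρ T (r * Complex.exp (t * Complex.I))
        (v - Complex.exp (2 * t * Complex.I) • w))
      (Summable.of_nonneg_of_le (fun _ => norm_nonneg _) (fun k => norm_sub_le _ _) (hs1.add hs2))
      (fun t => ?_) (fun t => Real.le_sqrt_of_sq_le (h r h0 h1 t)) k
    have hv := hasSum_rhoKernel_apply hT h0 h1 t v
    have hw := ((Equiv.subRight (2 : ℤ)).hasSum_iff (f := fun k : ℤ =>
      Complex.exp (k * t * Complex.I) • B r w k) |>.2 (hasSum_rhoKernel_apply hT h0 h1 t w)).const_smul (Complex.exp (2 * t * Complex.I))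
    have hexp : ∀ k : ℤ, Complex.exp (2 * t * Complex.I) *
        Complex.exp ((k - 2 : ℤ) * t * Complex.I) = Complex.exp (k * t * Complex.I) := by
      intro k
      rw [← Complex.exp_add]
      push_cast; ring_nf
    simp only [Function.comp_apply, Equiv.subRight_apply, smul_smul _ (Complex.exp _), hexp] at hw
    rw [map_sub, map_smul]
    simpa only [smul_sub] using hv.sub hw
  have hlim : Filter.Tendsto (fun r : ℝ => ‖B r v k - B r w (k - 2)‖) (nhdsWithin 1 (Set.Iio 1))
      (nhds ‖B 1 v k - B 1 w (k - 2)‖) := by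
    refine (Continuous.tendsto ?_ 1).mono_left nhdsWithin_le_nhds
    simp only [B]
    fun_prop
  have hlim' : Filter.Tendsto (fun r : ℝ => √(C * (1 - r ^ 2))) (nhdsWithin 1 (Set.Iio 1))
      (nhds √(C * (1 - 1 ^ 2))) :=
    (Continuous.tendsto (by fun_prop) 1).mono_left nhdsWithin_le_nhds
  have hle := le_of_tendsto_of_tendsto hlim hlim' (by
    filter_upwards [Ioo_mem_nhdsLT (zero_lt_one (α := ℝ))] with r hr
    exact key r hr.1.le hr.2)
  have h0 : ‖B 1 v k - B 1 w (k - 2)‖ = 0 := le_antisymm (by simpa using hle) (norm_nonneg _)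
  rw [norm_eq_zero, sub_eq_zero] at h0
  simpa [B] using h0

end RhoKernel

section HilbertBasisPermutation

variable {ι K : Type*} [NormedAddCommGroup K] [InnerProductSpace ℂ K]

lemma HilbertBasis.top_le_closure_span_comp (b : HilbertBasis ι ℂ K) (σ : Equiv.Perm ι) :
    ⊤ ≤ (Submodule.span ℂ (Set.range (b ∘ σ))).topologicalClosure := by
  rw [σ.surjective.range_comp, b.dense_span]

/-- The linear isometry permuting the vectors of a Hilbert basis. -/
noncomputable def HilbertBasis.permute [CompleteSpace K] (b : HilbertBasis ι ℂ K)
    (σ : Equiv.Perm ι) : K ≃ₗᵢ[ℂ] K :=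
  b.repr.trans (HilbertBasis.mk (b.orthonormal.comp σ σ.injective)
    (b.top_le_closure_span_comp σ)).repr.symm

lemma HilbertBasis.permute_apply [CompleteSpace K] (b : HilbertBasis ι ℂ K) (σ : Equiv.Perm ι)
    (i : ι) : b.permute σ (b i) = b (σ i) := by
  classical
  rw [permute, LinearIsometryEquiv.trans_apply, b.repr_self, HilbertBasis.repr_symm_single,
    HilbertBasis.coe_mk, Function.comp_apply]

lemma HilbertBasis.permute_pow_apply [CompleteSpace K] (b : HilbertBasis ι ℂ K)
    (σ : Equiv.Perm ι) (n : ℕ) (i : ι) :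
    ((b.permute σ : K →L[ℂ] K) ^ n) (b i) = b ((σ ^ n) i) := by
  induction n with
  | zero => simp
  | succ n ih =>
    rw [pow_succ', pow_succ', mul_apply_eq_comp, ih]
    exact b.permute_apply σ _

end HilbertBasisPermutation

lemma LinearIsometryEquiv.coe_mem_unitary {K : Type*} [NormedAddCommGroup K]
    [InnerProductSpace ℂ K] [CompleteSpace K] (e : K ≃ₗᵢ[ℂ] K) :
    (e : K →L[ℂ] K) ∈ unitary (K →L[ℂ] K) :=
  (Unitary.linearIsometryEquiv.symm e).property

/-- The matrix with weights `p`, `s` above the diagonal. -/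
def weightedShift (p s : ℂ) : Matrix (Fin 3) (Fin 3) ℂ :=
  !![0, p, 0; 0, 0, s; 0, 0, 0]

lemma weightedShift_sq (p s : ℂ) : weightedShift p s ^ 2 = !![0, 0, p * s; 0, 0, 0; 0, 0, 0] := by
  rw [sq]
  ext i j; fin_cases i <;> fin_cases j <;> simp [weightedShift, Matrix.mul_apply, Fin.sum_univ_three]

lemma weightedShift_pow_three (p s : ℂ) : weightedShift p s ^ 3 = 0 := by
  rw [pow_succ, weightedShift_sq]
  ext i j; fin_cases i <;> fin_cases j <;> simp [weightedShift, Matrix.mul_apply, Fin.sum_univ_three]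

lemma mul_conj_eq_two {p : ℂ} (hp : ‖p‖ = √2) : p * (starRingEnd ℂ) p = 2 := by
  rw [Complex.mul_conj, Complex.normSq_eq_norm_sq, hp, Real.sq_sqrt (by norm_num)]; norm_num

section Dilation

variable {K : Type*} [NormedAddCommGroup K] [InnerProductSpace ℂ K]

/-- The embedding of `ℂ³` whose shifted copies overlap as the powers of a weighted shift. -/
noncomputable def dilationEmbedding (b : HilbertBasis (ℤ × Bool) ℂ K) (p s : ℂ) :
    EuclideanSpace ℂ (Fin 3) →ₗ[ℂ] K where
  toFun x := x 0 • b (0, false) + (p / 2 * x 1) • b (1, false) + (p * s / 2 * x 2) • b (2, false)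
    + (((√2)⁻¹ : ℝ) * x 1) • b (0, true)
  map_add' x y := by simp only [PiLp.add_apply]; module
  map_smul' c x := by simp only [PiLp.smul_apply, smul_eq_mul, RingHom.id_apply]; module

lemma inner_dilationEmbedding (b : HilbertBasis (ℤ × Bool) ℂ K) {p s : ℂ}
    (hp : ‖p‖ = √2) (hs : ‖s‖ = √2) (x y : EuclideanSpace ℂ (Fin 3)) :
    inner ℂ (dilationEmbedding b p s x) (dilationEmbedding b p s y) = inner ℂ x y := by
  have hp' := mul_conj_eq_two hp
  have hs' := mul_conj_eq_two hs
  have h2 : (((√2)⁻¹ : ℝ) : ℂ) ^ 2 = 1 / 2 := by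
    rw [← Complex.ofReal_pow, inv_pow, Real.sq_sqrt (by norm_num)]; norm_num
  simp only [dilationEmbedding, LinearMap.coe_mk, AddHom.coe_mk, inner_add_left, inner_add_right,
    inner_smul_left, inner_smul_right, orthonormal_iff_ite.1 b.orthonormal, PiLp.inner_apply,
    Fin.sum_univ_three, RCLike.inner_apply, map_mul, Complex.conj_ofReal, map_div₀]
  norm_num
  rw [map_ofNat, ← Complex.ofReal_inv]
  linear_combination (1 / 4 * y 1 * (starRingEnd ℂ) (x 1)
      + 1 / 4 * s * (starRingEnd ℂ) s * y 2 * (starRingEnd ℂ) (x 2)) * hp'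
    + 1 / 2 * y 2 * (starRingEnd ℂ) (x 2) * hs' + y 1 * (starRingEnd ℂ) (x 1) * h2

variable [CompleteSpace K]

/-- The backward shift in the first coordinate. -/
noncomputable def dilationShift (b : HilbertBasis (ℤ × Bool) ℂ K) : K ≃ₗᵢ[ℂ] K :=
  b.permute ((Equiv.subRight (1 : ℤ)).prodCongr (Equiv.refl Bool))

lemma dilationShift_pow_apply (b : HilbertBasis (ℤ × Bool) ℂ K) (n : ℕ) (k : ℤ) (i : Bool) :
    ((dilationShift b : K →L[ℂ] K) ^ n) (b (k, i)) = b (k - n, i) := by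
  rw [dilationShift, b.permute_pow_apply]
  congr 1
  induction n with
  | zero => simp
  | succ n ih =>
    rw [pow_succ', Equiv.Perm.mul_apply, ih]
    simp [sub_sub]

lemma inner_dilationEmbedding_dilationShift (b : HilbertBasis (ℤ × Bool) ℂ K) {p s : ℂ}
    (hp : ‖p‖ = √2) {n : ℕ} (hn : 1 ≤ n)
    (x y : EuclideanSpace ℂ (Fin 3)) :
    inner ℂ y (Matrix.toEuclideanCLM (𝕜 := ℂ) (weightedShift p s ^ n) x) =
    2 * inner ℂ (dilationEmbedding b p s y)
      (((dilationShift b : K →L[ℂ] K) ^ n) (dilationEmbedding b p s x)) := by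
  have hp' := mul_conj_eq_two hp
  simp only [dilationEmbedding, LinearMap.coe_mk, AddHom.coe_mk, map_add, map_smul,
    dilationShift_pow_apply, inner_add_left, inner_add_right,
    inner_smul_left, inner_smul_right, orthonormal_iff_ite.1 b.orthonormal, PiLp.inner_apply,
    RCLike.inner_apply, map_mul, Complex.conj_ofReal, map_div₀,
    Matrix.ofLp_toEuclideanCLM, Matrix.mulVec_eq_sum, Fin.sum_univ_three]
  obtain rfl | rfl | hn : n = 1 ∨ n = 2 ∨ 3 ≤ n := by omega
  · simp [weightedShift]
    rw [map_ofNat]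
    linear_combination (-(1 / 2) * s * x 2 * (starRingEnd ℂ) (y 1)) * hp'
  · rw [weightedShift_sq]
    simp
    ring
  · obtain ⟨m, rfl⟩ := Nat.exists_eq_add_of_le hn
    rw [pow_add, weightedShift_pow_three, zero_mul]
    have hne : ∀ j k : ℤ, 0 ≤ j → k ≤ 2 → (j = k - (3 + m : ℕ)) = False := fun j k hj hk => by
      rw [eq_iff_iff, iff_false]
      push_cast; omega
    simp only [Prod.mk.injEq, hne, le_refl, zero_le_one, zero_le_two, one_le_two, false_and]
    simp

end Dilation

/-- A weighted shift on `ℂ³` with weights of modulus `√2` has a unitary `2`-dilation. -/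
lemma isRhoContraction_weightedShift {p s : ℂ} (hp : ‖p‖ = √2) (hs : ‖s‖ = √2) :
    IsRhoContraction 2 (Matrix.toEuclideanCLM (𝕜 := ℂ) (weightedShift p s)) := by
  let K := lp (fun _ : ℤ × Bool => ℂ) 2
  let b : HilbertBasis (ℤ × Bool) ℂ K := HilbertBasis.ofRepr (LinearIsometryEquiv.refl ℂ K)
  refine ⟨K, inferInstance, inferInstance, inferInstance,
    (dilationEmbedding b p s).isometryOfInner (inner_dilationEmbedding b hp hs),
    dilationShift b, LinearIsometryEquiv.coe_mem_unitary _, fun n hn => ?_⟩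
  ext1 x
  refine ext_inner_left ℂ fun y => ?_
  rw [← map_pow, inner_dilationEmbedding_dilationShift b hp hn, smul_apply,
    inner_smul_right, ContinuousLinearMap.comp_apply, ContinuousLinearMap.adjoint_inner_right]
  norm_num

lemma Ring.inverse_one_sub_of_pow_three_eq_zero {R : Type*} [Ring R] {x : R} (h : x ^ 3 = 0) :
    Ring.inverse (1 - x) = 1 + x + x ^ 2 := by
  let u : Rˣ := ⟨1 - x, 1 + x + x ^ 2,
    by rw [← sub_eq_zero, ← neg_eq_zero, ← h]; noncomm_ring,
    by rw [← sub_eq_zero, ← neg_eq_zero, ← h]; noncomm_ring⟩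
  exact Ring.inverse_unit u

lemma rhoKernel_two_of_pow_three_eq_zero {H : Type*} [NormedAddCommGroup H]
    [InnerProductSpace ℂ H] [CompleteSpace H] {T : H →L[ℂ] H} (h : T ^ 3 = 0) (z : ℂ) :
    rhoKernel 2 T z = (1 + (starRingEnd ℂ) z • T + ((starRingEnd ℂ) z) ^ 2 • T ^ 2) +
      (1 + z • ContinuousLinearMap.adjoint T + z ^ 2 • ContinuousLinearMap.adjoint T ^ 2) := by
  have h' : ContinuousLinearMap.adjoint T ^ 3 = 0 := by
    rw [← ContinuousLinearMap.star_eq_adjoint, ← star_pow, h, star_zero]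
  rw [rhoKernel, Ring.inverse_one_sub_of_pow_three_eq_zero (by rw [smul_pow, h, smul_zero]),
    Ring.inverse_one_sub_of_pow_three_eq_zero (by rw [smul_pow, h', smul_zero])]
  simp [smul_pow]

/-- A positive quadratic form equivalent to that of the `2`-kernel of `weightedShift p s`,
where `m = p * s`. -/
noncomputable def shiftForm (m z : ℂ) (x : EuclideanSpace ℂ (Fin 3)) : ℝ :=
  ‖x 0 + m * (starRingEnd ℂ) z ^ 2 / 2 * x 2‖ ^ 2 + (1 - ‖z‖ ^ 4) * ‖x 2‖ ^ 2 + ‖x 1‖ ^ 2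

lemma shiftForm_nonneg (m : ℂ) {z : ℂ} (hz : ‖z‖ < 1) (x : EuclideanSpace ℂ (Fin 3)) :
    0 ≤ shiftForm m z x := by
  have : ‖z‖ ^ 4 ≤ 1 := pow_le_one₀ (norm_nonneg z) hz.le
  have : 0 ≤ (1 - ‖z‖ ^ 4) * ‖x 2‖ ^ 2 := mul_nonneg (by linarith) (by positivity)
  unfold shiftForm
  positivity

lemma inner_rhoKernel_weightedShift {p s : ℂ} (hp : ‖p‖ = √2) (hs : ‖s‖ = √2) (z : ℂ)
    (x : EuclideanSpace ℂ (Fin 3)) :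
    inner ℂ (rhoKernel 2 (Matrix.toEuclideanCLM (𝕜 := ℂ) (weightedShift p s)) z x) x =
      ((2 * shiftForm (p * s) z x + 2 * ((starRingEnd ℂ) (x 1) *
        ((starRingEnd ℂ) p * z * (x 0 + p * s * (starRingEnd ℂ) z ^ 2 / 2 * x 2) +
          (1 - z * (starRingEnd ℂ) z) * s * (starRingEnd ℂ) z * x 2)).re : ℝ) : ℂ) := by
  have hp' := mul_conj_eq_two hp
  have hs' := mul_conj_eq_two hs
  have hre : ∀ u : ℂ, ((2 * u.re : ℝ) : ℂ) = u + (starRingEnd ℂ) u := fun u => by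
    rw [Complex.add_conj]
  have hn : ∀ u : ℂ, ((‖u‖ ^ 2 : ℝ) : ℂ) = u * (starRingEnd ℂ) u := fun u => by
    rw [Complex.mul_conj, Complex.normSq_eq_norm_sq]
  have h4 : ‖z‖ ^ 4 = (‖z‖ ^ 2) ^ 2 := by ring
  rw [rhoKernel_two_of_pow_three_eq_zero (by rw [← map_pow, weightedShift_pow_three, map_zero]),
    ← ContinuousLinearMap.star_eq_adjoint, ← map_star,
    ← map_pow Matrix.toEuclideanCLM, ← map_pow Matrix.toEuclideanCLM, ← star_pow,
    weightedShift_sq, Complex.ofReal_add, hre, shiftForm, Complex.ofReal_mul, Complex.ofReal_add,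
    Complex.ofReal_add, Complex.ofReal_mul, Complex.ofReal_sub, h4, Complex.ofReal_pow (‖z‖ ^ 2),
    hn, hn, hn, hn]
  simp only [PiLp.inner_apply, Fin.sum_univ_three, RCLike.inner_apply,
    add_apply, smul_apply, one_apply_eq_self,
    PiLp.add_apply, PiLp.smul_apply, Matrix.ofLp_toEuclideanCLM, Matrix.mulVec, dotProduct]
  simp [weightedShift]
  rw [map_ofNat]
  linear_combination
    (-(1 / 2) * (z * (starRingEnd ℂ) z) ^ 2 * (x 2 * (starRingEnd ℂ) (x 2)) *
        (s * (starRingEnd ℂ) s)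
      - (1 / 2) * (starRingEnd ℂ) (x 1) * z * s * (starRingEnd ℂ) z ^ 2 * x 2
      - (1 / 2) * x 1 * (starRingEnd ℂ) z * (starRingEnd ℂ) s * z ^ 2 * (starRingEnd ℂ) (x 2)) * hp'
    - (z * (starRingEnd ℂ) z) ^ 2 * (x 2 * (starRingEnd ℂ) (x 2)) * hs'

lemma abs_re_inner_rhoKernel_weightedShift_sub_le {p s z : ℂ} (hp : ‖p‖ = √2) (hs : ‖s‖ = √2)
    (hz : ‖z‖ < 1) (x : EuclideanSpace ℂ (Fin 3)) :
    |(inner ℂ (rhoKernel 2 (Matrix.toEuclideanCLM (𝕜 := ℂ) (weightedShift p s)) z x) x).re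
      - 2 * shiftForm (p * s) z x| ≤ √2 * shiftForm (p * s) z x := by
  rw [inner_rhoKernel_weightedShift hp hs, Complex.ofReal_re, add_sub_cancel_left]
  set A : ℂ := x 0 + p * s * (starRingEnd ℂ) z ^ 2 / 2 * x 2 with hA
  set B : ℂ := (starRingEnd ℂ) p * z * A + (1 - z * (starRingEnd ℂ) z) * s * (starRingEnd ℂ) z * x 2
  have h2 : √2 ^ 2 = 2 := Real.sq_sqrt (by norm_num)
  have hd : ‖(1 - z * (starRingEnd ℂ) z : ℂ)‖ = 1 - ‖z‖ ^ 2 := by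
    rw [Complex.mul_conj, Complex.normSq_eq_norm_sq, ← Complex.ofReal_one, ← Complex.ofReal_sub,
      Complex.norm_real, Real.norm_of_nonneg]
    nlinarith [norm_nonneg z]
  have hB : ‖B‖ ≤ √2 * ‖z‖ * (‖A‖ + (1 - ‖z‖ ^ 2) * ‖x 2‖) := by
    refine (norm_add_le _ _).trans (le_of_eq ?_)
    simp only [norm_mul, hd, RCLike.norm_conj, hp, hs]
    ring
  have hd0 : 0 ≤ 1 - ‖z‖ ^ 2 := by nlinarith [norm_nonneg z]
  have hB2 : ‖B‖ ^ 2 ≤ 2 * (‖A‖ ^ 2 + (1 - ‖z‖ ^ 4) * ‖x 2‖ ^ 2) := by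
    refine (pow_le_pow_left₀ (norm_nonneg _) hB 2).trans ?_
    rw [mul_pow, mul_pow, h2]
    have := mul_nonneg hd0 (add_nonneg (sq_nonneg (‖A‖ - ‖z‖ ^ 2 * ‖x 2‖)) (sq_nonneg ‖x 2‖))
    linarith
  have hre : |((starRingEnd ℂ) (x 1) * B).re| ≤ ‖x 1‖ * ‖B‖ := by
    refine (Complex.abs_re_le_norm _).trans ?_
    rw [norm_mul, RCLike.norm_conj]
  rw [abs_mul, abs_two]
  have hs0 : shiftForm (p * s) z x = ‖A‖ ^ 2 + (1 - ‖z‖ ^ 4) * ‖x 2‖ ^ 2 + ‖x 1‖ ^ 2 := rfl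
  have hsq := sq_nonneg (√2 * ‖x 1‖ - ‖B‖)
  have h5 : √2 * (2 * |((starRingEnd ℂ) (x 1) * B).re|) ≤ √2 * (√2 * shiftForm (p * s) z x) := by
    have : √2 * |((starRingEnd ℂ) (x 1) * B).re| ≤ √2 * (‖x 1‖ * ‖B‖) := by gcongr
    rw [← mul_assoc √2 √2, ← sq, h2, hs0]
    nlinarith
  exact le_of_mul_le_mul_left h5 (by positivity)

lemma isPositive_rhoKernel_weightedShift {p s z : ℂ} (hp : ‖p‖ = √2) (hs : ‖s‖ = √2)
    (hz : ‖z‖ < 1) :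
    (rhoKernel 2 (Matrix.toEuclideanCLM (𝕜 := ℂ) (weightedShift p s)) z).IsPositive := by
  rw [ContinuousLinearMap.isPositive_iff_complex]
  refine fun x => ⟨by rw [inner_rhoKernel_weightedShift hp hs]; simp, ?_⟩
  have h := (abs_le.1 (abs_re_inner_rhoKernel_weightedShift_sub_le hp hs hz x)).1
  have h2 : √2 ≤ 2 := Real.sqrt_le_iff.2 (by norm_num)
  have := mul_le_mul_of_nonneg_right h2 (shiftForm_nonneg (p * s) hz x)
  rw [RCLike.re_to_complex]
  linarith

lemma re_inner_rhoKernel_weightedShift_le {p s z : ℂ} (hp : ‖p‖ = √2) (hs : ‖s‖ = √2)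
    (hz : ‖z‖ < 1) (x : EuclideanSpace ℂ (Fin 3)) :
    (inner ℂ (rhoKernel 2 (Matrix.toEuclideanCLM (𝕜 := ℂ) (weightedShift p s)) z x) x).re
      ≤ 4 * shiftForm (p * s) z x := by
  have h := (abs_le.1 (abs_re_inner_rhoKernel_weightedShift_sub_le hp hs hz x)).2
  have h2 : √2 ≤ 2 := Real.sqrt_le_iff.2 (by norm_num)
  have := mul_le_mul_of_nonneg_right h2 (shiftForm_nonneg (p * s) hz x)
  linarith

lemma shiftForm_le {p s z : ℂ} (hp : ‖p‖ = √2) (hs : ‖s‖ = √2) (hz : ‖z‖ < 1)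
    (x : EuclideanSpace ℂ (Fin 3)) : shiftForm (p * s) z x ≤ 3 * ‖x‖ ^ 2 := by
  have h2 : √2 * √2 = 2 := Real.mul_self_sqrt (by norm_num)
  have hA : ‖x 0 + p * s * (starRingEnd ℂ) z ^ 2 / 2 * x 2‖ ≤ ‖x 0‖ + ‖x 2‖ := by
    refine (norm_add_le _ _).trans ?_
    gcongr
    rw [norm_mul, norm_div, norm_mul, norm_mul, norm_pow, RCLike.norm_conj, hp, hs, h2,
      Complex.norm_ofNat]
    have : ‖z‖ ^ 2 ≤ 1 := pow_le_one₀ (norm_nonneg z) hz.le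
    refine mul_le_of_le_one_left (norm_nonneg _) (by linarith)
  have hA2 := pow_le_pow_left₀ (norm_nonneg _) hA 2
  have h4 : 0 ≤ ‖z‖ ^ 4 * ‖x 2‖ ^ 2 := by positivity
  rw [EuclideanSpace.norm_sq_eq, Fin.sum_univ_three, shiftForm]
  nlinarith [sq_nonneg (‖x 0‖ - ‖x 2‖), sq_nonneg ‖x 1‖, sq_nonneg ‖x 0‖]

lemma harnackDominated_weightedShift {p s q t : ℂ} (hp : ‖p‖ = √2) (hs : ‖s‖ = √2)
    (hq : ‖q‖ = √2) (ht : ‖t‖ = √2) (h : p * s = q * t) :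
    HarnackDominated 2 (Matrix.toEuclideanCLM (𝕜 := ℂ) (weightedShift p s))
      (Matrix.toEuclideanCLM (𝕜 := ℂ) (weightedShift q t)) := by
  refine ⟨isRhoContraction_weightedShift hp hs, isRhoContraction_weightedShift hq ht, 1 + √2,
    by simp, fun z hz => ?_⟩
  rw [ContinuousLinearMap.isPositive_iff_complex]
  intro x
  have h1 := (abs_le.1 (abs_re_inner_rhoKernel_weightedShift_sub_le hp hs hz x)).2
  have h2 := (abs_le.1 (abs_re_inner_rhoKernel_weightedShift_sub_le hq ht hz x)).1
  have hsq : √2 ^ 2 = 2 := Real.sq_sqrt (by norm_num)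
  rw [sub_apply, smul_apply, inner_sub_left,
    inner_smul_left, ← Complex.ofReal_pow, Complex.conj_ofReal]
  constructor
  · rw [inner_rhoKernel_weightedShift hp hs, inner_rhoKernel_weightedShift hq ht]
    rw [← Complex.ofReal_mul, ← Complex.ofReal_sub, RCLike.re_to_complex, Complex.ofReal_re]
  · rw [RCLike.re_to_complex, Complex.sub_re, Complex.re_ofReal_mul]
    rw [h] at h1
    set S := shiftForm (q * t) z x
    set F := (inner ℂ (rhoKernel 2 (Matrix.toEuclideanCLM (𝕜 := ℂ) (weightedShift q t)) z x) x).re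
    have h3 : (1 + √2) ^ 2 * (2 * S - √2 * S) ≤ (1 + √2) ^ 2 * F := by
      gcongr
      linarith
    have h4 : (1 + √2) ^ 2 * (2 * S - √2 * S) = 2 * S + √2 * S := by
      linear_combination (-√2 * S) * hsq
    linarith

/-- The vector multiplying `-e^{2it}` in the boundary kernel vector of the `2`-kernel. -/
noncomputable def boundaryVector (m : ℂ) : EuclideanSpace ℂ (Fin 3) :=
  WithLp.toLp 2 ![0, 0, (starRingEnd ℂ) m / 2]

lemma shiftForm_boundaryVector {m : ℂ} (hm : ‖m‖ = 2) {r : ℝ} (t : ℝ) (h0 : 0 ≤ r) :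
    shiftForm m (r * Complex.exp (t * Complex.I)) (WithLp.toLp 2 ![1, 0, 0] -
      Complex.exp (2 * t * Complex.I) • boundaryVector m) = 2 * (1 - r ^ 2) := by
  have hm' : m * (starRingEnd ℂ) m = 4 := by
    rw [Complex.mul_conj, Complex.normSq_eq_norm_sq, hm]; norm_num
  have he : Complex.exp (-(t * Complex.I)) ^ 2 * Complex.exp (2 * t * Complex.I) = 1 := by
    rw [← Complex.exp_nat_mul, ← Complex.exp_add, ← Complex.exp_zero]; congr 1; push_cast; ring
  have hc : (starRingEnd ℂ) (Complex.exp (t * Complex.I)) = Complex.exp (-(t * Complex.I)) := by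
    rw [← Complex.exp_conj]; simp
  have hA : (1 : ℂ) + m * (starRingEnd ℂ) (r * Complex.exp (t * Complex.I)) ^ 2 / 2 *
      -(Complex.exp (2 * t * Complex.I) * ((starRingEnd ℂ) m / 2)) = ((1 - r ^ 2 : ℝ) : ℂ) := by
    rw [map_mul, Complex.conj_ofReal, hc]
    push_cast
    linear_combination (-(r : ℂ) ^ 2) * he - 1 / 4 * (r : ℂ) ^ 2 *
      Complex.exp (-(t * Complex.I)) ^ 2 * Complex.exp (2 * t * Complex.I) * hm'
  have h2 : ‖Complex.exp (2 * t * Complex.I)‖ = 1 := by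
    simpa using Complex.norm_exp_ofReal_mul_I (2 * t)
  have hz : ‖(r : ℂ) * Complex.exp (t * Complex.I)‖ = r := by
    rw [norm_mul, Complex.norm_exp_ofReal_mul_I, Complex.norm_real, Real.norm_of_nonneg h0, mul_one]
  rw [shiftForm, hz]
  simp only [boundaryVector, PiLp.sub_apply, PiLp.smul_apply, smul_eq_mul, Matrix.cons_val,
    mul_zero, sub_zero, zero_sub, norm_zero]
  rw [hA, Complex.norm_real, Real.norm_eq_abs, sq_abs, norm_neg, norm_mul, h2, norm_div,
    RCLike.norm_conj, hm, Complex.norm_ofNat]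
  ring

open scoped ComplexOrder in
/-- An operator Harnack equivalent to `weightedShift p s` obeys the moment recursion coming from
the boundary kernel of the latter. -/
lemma rhoMoment_eq_of_harnackEquivalent {p s : ℂ} (hp : ‖p‖ = √2) (hs : ‖s‖ = √2)
    {T : EuclideanSpace ℂ (Fin 3) →L[ℂ] EuclideanSpace ℂ (Fin 3)}
    (h : HarnackEquivalent 2 T (Matrix.toEuclideanCLM (𝕜 := ℂ) (weightedShift p s))) (k : ℤ) :
    rhoMoment 2 T k (WithLp.toLp 2 ![1, 0, 0])
      = rhoMoment 2 T (k - 2) (boundaryVector (p * s)) := by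
  obtain ⟨⟨hT, -, c, hc, hdom⟩, ⟨-, -, d, hd, hdom'⟩⟩ := h
  have hpos : ∀ z : ℂ, ‖z‖ < 1 → (rhoKernel 2 T z).IsPositive := by
    intro z hz
    have h1 := (hdom' z hz).add (isPositive_rhoKernel_weightedShift hp hs hz)
    rw [sub_add_cancel] at h1
    have hd0 : (0 : ℂ) ≤ (((d ^ 2)⁻¹ : ℝ) : ℂ) := by
      rw [Complex.zero_le_real]; positivity
    have h2 := h1.smul_of_nonneg hd0
    rwa [smul_smul, ← Complex.ofReal_pow, ← Complex.ofReal_mul, inv_mul_cancel₀ (by positivity),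
      Complex.ofReal_one, one_smul] at h2
  have hle : ∀ z : ℂ, ‖z‖ < 1 → ∀ x, (inner ℂ (rhoKernel 2 T z x) x).re
      ≤ c ^ 2 * (4 * shiftForm (p * s) z x) := by
    intro z hz x
    have h1 := (hdom z hz).re_inner_nonneg_left x
    rw [sub_apply, smul_apply, inner_sub_left, inner_smul_left, ← Complex.ofReal_pow,
      Complex.conj_ofReal, RCLike.re_to_complex, Complex.sub_re, Complex.re_ofReal_mul] at h1
    have h2 := mul_le_mul_of_nonneg_left (re_inner_rhoKernel_weightedShift_le hp hs hz x)
      (sq_nonneg c)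
    linarith
  have hm : ‖p * s‖ = 2 := by rw [norm_mul, hp, hs]; exact Real.mul_self_sqrt (by norm_num)
  refine rhoMoment_apply_eq_of_rhoKernel_le hT (C := (c ^ 2 * 12) * (c ^ 2 * 8)) ?_ k
  intro r h0 h1 t
  have hz : ‖(r : ℂ) * Complex.exp (t * Complex.I)‖ < 1 := by
    rwa [norm_mul, Complex.norm_exp_ofReal_mul_I, Complex.norm_real, Real.norm_of_nonneg h0,
      mul_one]
  refine ((hpos _ hz).norm_apply_sq_le (C := c ^ 2 * 12) (by positivity) (fun x => ?_) _).trans ?_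
  · refine (hle _ hz x).trans ?_
    rw [mul_assoc]
    refine mul_le_mul_of_nonneg_left ?_ (sq_nonneg c)
    linarith [shiftForm_le hp hs hz x]
  · rw [mul_assoc (c ^ 2 * 12)]
    refine mul_le_mul_of_nonneg_left ?_ (by positivity)
    refine (hle _ hz _).trans (le_of_eq ?_)
    rw [shiftForm_boundaryVector hm t h0]
    ring

lemma exists_eq_weightedShift_of_harnackEquivalent {p s : ℂ} (hp : ‖p‖ = √2) (hs : ‖s‖ = √2)
    {T : Matrix (Fin 3) (Fin 3) ℂ}
    (h : HarnackEquivalent 2 (Matrix.toEuclideanCLM (𝕜 := ℂ) T)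
      (Matrix.toEuclideanCLM (𝕜 := ℂ) (weightedShift p s))) :
    ∃ q t : ℂ, ‖q‖ = √2 ∧ ‖t‖ = √2 ∧ q * t = p * s ∧ T = weightedShift q t := by
  have hm : p * s * (starRingEnd ℂ) (p * s) = 4 := by
    rw [map_mul]
    linear_combination (s * (starRingEnd ℂ) s) * mul_conj_eq_two hp + 2 * mul_conj_eq_two hs
  have hm0 : (starRingEnd ℂ) (p * s) ≠ 0 := right_ne_zero_of_mul (hm.trans_ne (by norm_num))
  set m := p * s
  set A := Matrix.toEuclideanCLM (𝕜 := ℂ) T with hA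
  set e : EuclideanSpace ℂ (Fin 3) := WithLp.toLp 2 ![1, 0, 0] with he
  set w := boundaryVector m with hw
  have key := rhoMoment_eq_of_harnackEquivalent hp hs h
  have m0 : rhoMoment 2 A 0 = ((2 : ℝ) : ℂ) • 1 := rfl
  have m1 : rhoMoment 2 A 1 = ContinuousLinearMap.adjoint A := pow_one _
  have n1 : rhoMoment 2 A (-1) = A := pow_one _
  have n2 : rhoMoment 2 A (-2) = A ^ 2 := rfl
  have n3 : rhoMoment 2 A (-3) = A ^ 3 := rfl
  have h0 : (2 : ℂ) • e = A (A w) := by simpa [m0, n2, pow_succ] using key 0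
  have hn1 : A e = A (A (A w)) := by simpa [n1, n3, pow_succ] using key (-1)
  have h1 : ContinuousLinearMap.adjoint A e = A w := by simpa [m1, n1] using key 1
  have h2 : ContinuousLinearMap.adjoint A (ContinuousLinearMap.adjoint A e) = (2 : ℂ) • w := by
    simpa [rhoMoment, pow_succ] using key 2
  have h3 : ContinuousLinearMap.adjoint A (ContinuousLinearMap.adjoint A
      (ContinuousLinearMap.adjoint A e)) = ContinuousLinearMap.adjoint A w := by
    simpa [rhoMoment, pow_succ] using key 3
  have hAe : A e = 0 := by
    rw [← h0, map_smul, two_smul] at hn1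
    simpa using hn1
  have hAw : ContinuousLinearMap.adjoint A w = 0 := by
    rw [h2, map_smul, two_smul] at h3
    simpa using h3
  rw [← ContinuousLinearMap.star_eq_adjoint, hA, ← map_star] at h1 hAw
  have hcol : ∀ i, T i 0 = 0 := fun i => by
    have := congrArg (fun v : EuclideanSpace ℂ (Fin 3) => v i) hAe
    simpa [hA, he, Matrix.ofLp_toEuclideanCLM, Matrix.mulVec_eq_sum, Fin.sum_univ_three] using this
  have hrow : ∀ i, T 2 i = 0 := fun i => by
    have := congrArg (fun v : EuclideanSpace ℂ (Fin 3) => v i) hAw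
    simpa [hw, boundaryVector, Matrix.ofLp_toEuclideanCLM, Matrix.mulVec_eq_sum,
      Fin.sum_univ_three, hm0] using this
  have hmid : ∀ i, (starRingEnd ℂ) (T 0 i) = (starRingEnd ℂ) m / 2 * T i 2 := fun i => by
    have := congrArg (fun v : EuclideanSpace ℂ (Fin 3) => v i) h1
    simpa [hw, he, boundaryVector, Matrix.ofLp_toEuclideanCLM, Matrix.mulVec_eq_sum,
      Fin.sum_univ_three] using this
  have hsq : ∀ i, (2 : ℂ) * e i = (starRingEnd ℂ) m / 2 *
      (T i 0 * T 0 2 + T i 1 * T 1 2 + T i 2 * T 2 2) := fun i => by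
    have := congrArg (fun v : EuclideanSpace ℂ (Fin 3) => v i) h0
    simp [hA, hw, boundaryVector, Matrix.mulVec_eq_sum,
      Fin.sum_univ_three] at this
    linear_combination this
  have h02 : T 0 2 = 0 := by
    have := hmid 0
    rw [hcol 0, map_zero, eq_comm, mul_eq_zero] at this
    exact this.resolve_left (by simpa using hm0)
  have hprod : T 0 1 * T 1 2 = m := by
    have := hsq 0
    simp only [he, Matrix.cons_val, hrow, h02, hcol, mul_one, mul_zero, add_zero,
      zero_add] at this
    refine mul_left_cancel₀ hm0 ?_
    linear_combination -2 * this - hm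
  have hm0' : m ≠ 0 := left_ne_zero_of_mul (hm.trans_ne (by norm_num))
  have h12 : T 1 2 ≠ 0 := right_ne_zero_of_mul (hprod.trans_ne hm0')
  have h11 : T 1 1 = 0 := by
    have := hsq 1
    simp only [he, Matrix.cons_val, hrow, hcol, mul_zero, zero_mul, add_zero, zero_add] at this
    rw [eq_comm, mul_eq_zero, mul_eq_zero] at this
    exact (this.resolve_left (by simpa using hm0)).resolve_right h12
  have hmn : ‖m‖ = √2 * √2 := by rw [norm_mul, hp, hs]
  have h22 : √2 * √2 = 2 := Real.mul_self_sqrt (by norm_num)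
  have hnorm : ‖T 0 1‖ = ‖T 1 2‖ := by
    have := congrArg norm (hmid 1)
    rwa [norm_mul, norm_div, RCLike.norm_conj, RCLike.norm_conj, hmn, h22, Complex.norm_ofNat,
      div_self two_ne_zero, one_mul] at this
  have hn := congrArg norm hprod
  rw [norm_mul, hmn, hnorm, mul_self_inj (norm_nonneg _) (Real.sqrt_nonneg _)] at hn
  refine ⟨T 0 1, T 1 2, hnorm.trans hn, hn, hprod, ?_⟩
  ext i j
  fin_cases i <;> fin_cases j <;> simp [weightedShift, hcol, hrow, h02, h11]

lemma mem_harnackPart_weightedShift_iff {p s : ℂ} (hp : ‖p‖ = √2) (hs : ‖s‖ = √2)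
    (T : Matrix (Fin 3) (Fin 3) ℂ) :
    Matrix.toEuclideanCLM (𝕜 := ℂ) T ∈
        harnackPart 2 (Matrix.toEuclideanCLM (𝕜 := ℂ) (weightedShift p s)) ↔
      ∃ q t : ℂ, ‖q‖ = √2 ∧ ‖t‖ = √2 ∧ q * t = p * s ∧ T = weightedShift q t := by
  refine ⟨exists_eq_weightedShift_of_harnackEquivalent hp hs, ?_⟩
  rintro ⟨q, t, hq, ht, h, rfl⟩
  exact ⟨harnackDominated_weightedShift hq ht hp hs h,
    harnackDominated_weightedShift hp hs hq ht h.symm⟩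

lemma smul_eq_weightedShift (a : ℂ) (θ : ℝ) :
    a • !![0, Complex.exp (-(Complex.I * θ)), 0; 0, 0, Complex.exp (Complex.I * θ); 0, 0, 0]
      = weightedShift (a * Complex.exp (-(Complex.I * θ))) (a * Complex.exp (Complex.I * θ)) := by
  ext i j
  fin_cases i <;> fin_cases j <;> simp [weightedShift]

lemma conj_exp_I_mul (θ : ℝ) :
    (starRingEnd ℂ) (Complex.exp (Complex.I * θ)) = Complex.exp (-(Complex.I * θ)) := by
  rw [← Complex.exp_conj]; simp

lemma conjTranspose_diagUnitary (θ : ℝ) : (diagUnitary θ).conjTranspose =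
    Matrix.diagonal ![Complex.exp (-(Complex.I * θ)), 1, Complex.exp (-(Complex.I * θ))] := by
  rw [diagUnitary, Matrix.diagonal_conjTranspose]
  congr 1
  ext i
  fin_cases i <;> simp [conj_exp_I_mul]

lemma diagUnitary_conj_nilpotentMatrix (a : ℂ) (θ : ℝ) :
    (diagUnitary θ).conjTranspose * nilpotentMatrix a * diagUnitary θ
      = weightedShift (a * Complex.exp (-(Complex.I * θ))) (a * Complex.exp (Complex.I * θ)) := by
  rw [conjTranspose_diagUnitary, diagUnitary]
  ext i j
  fin_cases i <;> fin_cases j <;> simp [weightedShift, nilpotentMatrix, mul_comm]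

lemma diagUnitary_mem_unitaryGroup (θ : ℝ) :
    diagUnitary θ ∈ Matrix.unitaryGroup (Fin 3) ℂ := by
  rw [Matrix.mem_unitaryGroup_iff', Matrix.star_eq_conjTranspose, conjTranspose_diagUnitary,
    diagUnitary, Matrix.diagonal_mul_diagonal, ← Matrix.diagonal_one]
  congr 1
  ext i
  fin_cases i <;> simp [← Complex.exp_add]

/-- The weighted shifts with weights of the same modulus as `a` and the same product as
`(a, a)` form a one-parameter family. -/
lemma exists_weights_iff {a : ℂ} (ha : ‖a‖ = √2) (T : Matrix (Fin 3) (Fin 3) ℂ) :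
    (∃ q t : ℂ, ‖q‖ = √2 ∧ ‖t‖ = √2 ∧ q * t = a * a ∧ T = weightedShift q t) ↔
      ∃ θ : ℝ, T = weightedShift (a * Complex.exp (-(Complex.I * θ)))
        (a * Complex.exp (Complex.I * θ)) := by
  have ha0 : a ≠ 0 := norm_ne_zero_iff.1 (by rw [ha]; positivity)
  constructor
  · rintro ⟨q, t, hq, ht, h, rfl⟩
    have h1 : ‖t / a‖ = 1 := by rw [norm_div, ht, ha, div_self (by positivity)]
    have ht' : a * Complex.exp (Complex.I * (t / a).arg) = t := by
      have := Complex.norm_mul_exp_arg_mul_I (t / a)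
      rw [h1, Complex.ofReal_one, one_mul, mul_comm] at this
      rw [this, mul_div_cancel₀ _ ha0]
    refine ⟨(t / a).arg, ?_⟩
    have ht0 : t ≠ 0 := norm_ne_zero_iff.1 (by rw [ht]; positivity)
    congr 1
    · refine mul_right_cancel₀ ht0 ?_
      rw [h]
      nth_rewrite 2 [← ht']
      rw [mul_mul_mul_comm, ← Complex.exp_add, neg_add_cancel, Complex.exp_zero, mul_one]
    · exact ht'.symm
  · rintro ⟨θ, rfl⟩
    refine ⟨_, _, ?_, ?_, ?_, rfl⟩
    · rw [norm_mul, ← conj_exp_I_mul, RCLike.norm_conj, Complex.norm_exp_I_mul_ofReal, mul_one, ha]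
    · rw [norm_mul, Complex.norm_exp_I_mul_ofReal, mul_one, ha]
    · rw [mul_mul_mul_comm, ← Complex.exp_add, neg_add_cancel, Complex.exp_zero, mul_one]

/-- A matrix is identified with the operator it induces on the Hilbert space `ℂ³`. The first
conjunct describes the Harnack part of `N` in `C_2(ℂ³)`; the other two say that it is the orbit of
`N` under conjugation by the unitary matrices `diag(e^{iθ}, 1, e^{iθ})`. -/
theorem theorem3p3 (a : ℂ) (ha : ‖a‖ = Real.sqrt 2) :
    {T : Matrix (Fin 3) (Fin 3) ℂ | Matrix.toEuclideanCLM (𝕜 := ℂ) T ∈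
        harnackPart 2 (Matrix.toEuclideanCLM (𝕜 := ℂ) (nilpotentMatrix a))}
      = {T | ∃ θ : ℝ, T = a • !![0, Complex.exp (-(Complex.I * θ)), 0;
                                  0, 0, Complex.exp (Complex.I * θ);
                                  0, 0, 0]} ∧
    (∀ θ : ℝ, diagUnitary θ ∈ Matrix.unitaryGroup (Fin 3) ℂ) ∧
    {T : Matrix (Fin 3) (Fin 3) ℂ | Matrix.toEuclideanCLM (𝕜 := ℂ) T ∈
        harnackPart 2 (Matrix.toEuclideanCLM (𝕜 := ℂ) (nilpotentMatrix a))}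
      = {T | ∃ θ : ℝ, T = (diagUnitary θ).conjTranspose * nilpotentMatrix a * diagUnitary θ} := by
  simp only [smul_eq_weightedShift, diagUnitary_conj_nilpotentMatrix]
  have h : {T : Matrix (Fin 3) (Fin 3) ℂ | Matrix.toEuclideanCLM (𝕜 := ℂ) T ∈
        harnackPart 2 (Matrix.toEuclideanCLM (𝕜 := ℂ) (nilpotentMatrix a))}
      = {T | ∃ θ : ℝ, T = weightedShift (a * Complex.exp (-(Complex.I * θ)))
        (a * Complex.exp (Complex.I * θ))} := by
    ext T
    exact (mem_harnackPart_weightedShift_iff ha ha T).trans (exists_weights_iff ha T)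
  exact ⟨h, diagUnitary_mem_unitaryGroup, h⟩
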